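/- Let $K$ be an algebraically closed field, let $k_1,k_2\ge 1$ be integers, and let $A,B\in \mathrm{M}(2,K)$ be nonzero. Let $\widetilde w:\mathrm{M}(2,K)^2\to \mathrm{M}(2,K)$, $\widetilde w(X,Y)=AX^{k_1}+BY^{k_2}$. Matrices are written $\begin{pmatrix}a&b\\c&d\end{pmatrix}=[a,b;c,d]$. Write $D(\lambda,\mu)=[\lambda,0;0,\mu]$ and $J(\lambda)=[\lambda,1;0,\lambda]$. Let $R_1$ (resp. $R_2$) be the subspace of matrices whose second (resp. first) row is zero, and $M=\mathrm{M}(2,K)$. Call a pair $(A,B)$ of nonzero matrices a *representative* if it is one of the following: (i) $A=D(\lambda,\lambda)$, $\lambda\ne0$, and $B$ is $D(\xi,\xi)$ with $\xi\neq 0$, or $D(\xi_1,\xi_2)$ with $\xi_1\ne\xi_2$, or $J(\xi)$; (ii) $A=D(\lambda,\mu)$, $\lambda\ne\mu$, and $B$ is $D(\xi,\xi)$ with $\xi\ne0$, or $D(\xi_1,\xi_2)$ with $\xi_1\neq\xi_2$, or $[\xi_1,1;0,\xi_2]$, or $[\xi_1,0;1,\xi_2]$, or $[\xi_1,\xi_2;1,\xi_3]$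 with all $\xi_i\ne0$, or $[0,\xi_2;1,\xi_3]$ with $\xi_3\ne0$, or $[\xi_1,\xi_2;1,0]$ with $\xi_1\ne0$, or $[0,\xi_2;1,0]$ with $\xi_2\neq0$; (iii) $A=J(\lambda)$ and $B$ is $[\xi_1,0;z,\xi_2]$ with $z\ne0$, or $D(\xi_1,\xi_2)$ with $\xi_1\neq\xi_2$, or $[\xi,z;0,\xi]\neq 0$. Then: 1. $(A,B)$ is simultaneously conjugate to a representative: there is $P\in \mathrm{GL}(2,K)$ such that $(PAP^{-1},PBP^{-1})$ is a representative. 2. $\widetilde w$ is surjective if and only if $(A,B)$ is simultaneously conjugate to a representative $(A',B')$ for which no row is zero in both $A'$ and $B'$. Equivalently, $\widetilde w$ is surjective if and only if for no $P\in\mathrm{GL}(2,K)$ the matrices $PAP^{-1}$ and $PBP^{-1}$ have a common zero row. 3. Every representative occurs in the following table, and for every pair $(A,B)$ of nonzero matrices in the table the image of $\widetilde w$ is the stated subspace (all parameters are arbitrary elements of $K$ subject to the stated conditions and to $A,B\ne 0$): 1. $D(\lambda,\lambda)$, $D(\xi,\xi)$: $M$ 2. $D(\lambda,\lambda)$, $D(\xi_1,\xi_2)$,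 $\xi_1\ne\xi_2$: $M$ 3. $D(\lambda,\lambda)$, $J(\xi)$: $M$ 4. $D(\lambda,\mu)$, $\lambda\ne\mu$, $D(\xi,\xi)$: $M$ 5. $D(\lambda,\mu)$, $\lambda\ne\mu$, $D(\xi_1,\xi_2)$, $\xi_1\xi_2\neq0$: $M$ 6. $D(\lambda,\mu)$, $\lambda\ne0$, $D(\xi_1,\xi_2)$, $\xi_2\neq0$: $M$ 7. $D(\lambda,\mu)$, $\mu\ne0$, $D(\xi_1,\xi_2)$, $\xi_1\neq0$: $M$ 8. $D(\lambda,0)$, $D(\xi,0)$: $R_1$ 9. $D(0,\mu)$, $D(0,\xi)$: $R_2$ 10. $D(\lambda,\mu)$, $\lambda\mu\ne0$, $J(\xi)$: $M$ 11. $D(\lambda,\mu)$, $\lambda\mu=0$, $J(\xi)$, $\xi\ne0$: $M$ 12. $D(\lambda,\mu)$, $\mu\ne0$, $J(0)$: $M$ 13. $D(\lambda,0)$, $J(0)$: $R_1$ 14. $D(\lambda,\mu)$, $\lambda\mu\ne0$, $[\xi_1,1;0,\xi_2]$, $\xi_1\ne\xi_2$: $M$ 15. $D(\lambda,\mu)$,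 $\lambda\mu=0$, $[\xi_1,1;0,\xi_2]$, $\xi_1\xi_2\ne0$: $M$ 16. $D(\lambda,\mu)$, $\mu\ne0$, $[\xi,1;0,0]$: $M$ 17. $D(\lambda,0)$, $[\xi,1;0,0]$: $R_1$ 18. $D(\lambda,0)$, $[0,1;0,\xi]$, $\xi\neq0$: $M$ 19. $D(0,\mu)$, $[0,1;0,\xi]$: $M$ 20. $D(\lambda,\mu)$, $\lambda\mu\ne0$, $[\xi,0;1,\xi]$: $M$ 21. $D(\lambda,\mu)$, $\lambda\mu=0$, $[\xi,0;1,\xi]$, $\xi\ne0$: $M$ 22. $D(\lambda,\mu)$, $\lambda\ne0$, $[0,0;1,0]$: $M$ 23. $D(0,\mu)$, $[0,0;1,0]$: $R_2$ 24. $D(\lambda,\mu)$, $\lambda\mu\ne0$, $[\xi_1,0;1,\xi_2]$, $\xi_1\ne\xi_2$: $M$ 25. $D(\lambda,\mu)$, $\lambda\mu=0$, $[\xi_1,0;1,\xi_2]$, $\xi_1\xi_2\ne0$: $M$ 26. $D(\lambda,0)$, $[\xi_1,0;1,\xi_2]$: $M$ 27. $D(0,\mu)$, $[\xi_1,0;1,\xi_2]$,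 $\xi_1\ne0$: $M$ 28. $D(0,\mu)$, $[0,0;1,\xi]$: $R_2$ 29. $D(\lambda,\mu)$, $\lambda\ne\mu$, $[\xi_1,\xi_2;1,\xi_3]$, all $\xi_i\ne0$: $M$ 30. $D(\lambda,\mu)$, $\lambda\mu\ne0$, $[0,\xi_2;1,\xi_3]$, $\xi_3\neq0$: $M$ 31. $D(\lambda,\mu)$, $[0,\xi_2;1,\xi_3]$, $\xi_2,\xi_3\neq0$: $M$ 32. $D(\lambda,\mu)$, $\lambda\ne\mu$, $[\xi_1,\xi_2;1,0]$, $\xi_1\ne0$: $M$ 33. $D(\lambda,\mu)$, $\lambda\ne\mu$, $[0,\xi;1,0]$, $\xi\ne0$: $M$ 34. $J(\lambda)$, $\lambda\neq0$, $[\xi,0;z,\xi]$, $\xi z\ne0$: $M$ 35. $J(0)$, $[\xi_1,0;z,\xi_2]$, $\xi_1\neq\xi_2$, $z\ne0$: $M$ 36. $J(\lambda)$, $\lambda\ne0$, $D(\xi_1,\xi_2)$, $\xi_1\ne\xi_2$: $M$ 37. $J(0)$, $[0,z;0,0]$: $R_1$ 38. $J(\lambda)$, $[\xi,z;0,\xi]$,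 $\xi\neq0$: $M$ 39. $J(\lambda)$, $[\xi_1,0;z,\xi_2]$, $z\ne0$: $M$ 40. $J(0)$, $D(\xi_1,\xi_2)$, $\xi_2\ne0$, $\xi_1\neq\xi_2$: $M$ 41. $J(0)$, $D(\xi,0)$: $R_1$ 42. $J(\lambda)$, $\lambda\ne0$, $[0,z;0,0]$: $M$ 4. In particular, if $(A,B)$ is a representative, the image of $\widetilde w$ is $M$, $R_1$ or $R_2$; and for all nonzero $A,B$ the image of $\widetilde w$ is a vector subspace of $\mathrm{M}(2,K)$. -/

import Mathlib

open Matrix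

/-- The map `(X, Y) ↦ A X ^ k₁ + B Y ^ k₂` on `M(2, K)`. -/
def powerSumMap {K : Type*} [Field K] (A B : Matrix (Fin 2) (Fin 2) K) (k₁ k₂ : ℕ) :
    Matrix (Fin 2) (Fin 2) K × Matrix (Fin 2) (Fin 2) K → Matrix (Fin 2) (Fin 2) K :=
  fun p => A * p.1 ^ k₁ + B * p.2 ^ k₂

/-- The conjugate `P A P⁻¹` of a matrix by an invertible matrix. -/
def conjBy {K : Type*} [Field K] (P : GL (Fin 2) K) (A : Matrix (Fin 2) (Fin 2) K) :
    Matrix (Fin 2) (Fin 2) K :=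
  (P : Matrix (Fin 2) (Fin 2) K) * A * ((P⁻¹ : GL (Fin 2) K) : Matrix (Fin 2) (Fin 2) K)

/-- No row is zero in both matrices. -/
def NoCommonZeroRow {K : Type*} [Field K] (A B : Matrix (Fin 2) (Fin 2) K) : Prop :=
  ∀ i, ¬ ((∀ j, A i j = 0) ∧ (∀ j, B i j = 0))

/-- The subspace of matrices all of whose rows except possibly row `i` are zero. -/
def rowSubspace (K : Type*) [Field K] (i : Fin 2) :
    Submodule K (Matrix (Fin 2) (Fin 2) K) where
  carrier := {C | ∀ i', i' ≠ i → ∀ j, C i' j = 0}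
  zero_mem' := by
    intro i' _ j
    rfl
  add_mem' := by
    intro a b ha hb i' hi j
    rw [Matrix.add_apply, ha i' hi j, hb i' hi j, add_zero]
  smul_mem' := by
    intro c a ha i' hi j
    rw [Matrix.smul_apply, ha i' hi j, smul_zero]

/-- The representatives of pairs of matrices under simultaneous conjugation: the first matrix is
in Jordan form, and the second one is normalized by the centralizer of the first. -/
inductive IsRepresentative {K : Type*} [Field K] :
    Matrix (Fin 2) (Fin 2) K → Matrix (Fin 2) (Fin 2) K → Prop
  -- first matrix scalar
  | scalar_scalar (l m : K) : l ≠ 0 → m ≠ 0 →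
      IsRepresentative !![l, 0; 0, l] !![m, 0; 0, m]
  | scalar_diag (l m₁ m₂ : K) : l ≠ 0 → m₁ ≠ m₂ →
      IsRepresentative !![l, 0; 0, l] !![m₁, 0; 0, m₂]
  | scalar_block (l m : K) : l ≠ 0 →
      IsRepresentative !![l, 0; 0, l] !![m, 1; 0, m]
  -- first matrix diagonal with distinct diagonal entries
  | diag_scalar (l l' m : K) : l ≠ l' → m ≠ 0 →
      IsRepresentative !![l, 0; 0, l'] !![m, 0; 0, m]
  | diag_diag (l l' m₁ m₂ : K) : l ≠ l' → m₁ ≠ m₂ →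
      IsRepresentative !![l, 0; 0, l'] !![m₁, 0; 0, m₂]
  | diag_upper_eq (l l' m : K) : l ≠ l' →
      IsRepresentative !![l, 0; 0, l'] !![m, 1; 0, m]
  | diag_upper_ne (l l' m₁ m₂ : K) : l ≠ l' → m₁ ≠ m₂ →
      IsRepresentative !![l, 0; 0, l'] !![m₁, 1; 0, m₂]
  | diag_lower_eq (l l' m : K) : l ≠ l' →
      IsRepresentative !![l, 0; 0, l'] !![m, 0; 1, m]
  | diag_lower_ne (l l' m₁ m₂ : K) : l ≠ l' → m₁ ≠ m₂ →
      IsRepresentative !![l, 0; 0, l'] !![m₁, 0; 1, m₂]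
  | diag_full (l l' z₁ z₂ z₃ : K) : l ≠ l' → z₁ ≠ 0 → z₂ ≠ 0 → z₃ ≠ 0 →
      IsRepresentative !![l, 0; 0, l'] !![z₁, z₂; 1, z₃]
  | diag_zero_left (l l' z₂ z₃ : K) : l ≠ l' → z₃ ≠ 0 →
      IsRepresentative !![l, 0; 0, l'] !![0, z₂; 1, z₃]
  | diag_zero_right (l l' z₁ z₂ : K) : l ≠ l' → z₁ ≠ 0 →
      IsRepresentative !![l, 0; 0, l'] !![z₁, z₂; 1, 0]
  | diag_anti (l l' z₂ : K) : l ≠ l' → z₂ ≠ 0 →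
      IsRepresentative !![l, 0; 0, l'] !![0, z₂; 1, 0]
  -- first matrix a Jordan block
  | block_lower (l m₁ m₂ z : K) : z ≠ 0 →
      IsRepresentative !![l, 1; 0, l] !![m₁, 0; z, m₂]
  | block_diag (l m₁ m₂ : K) : m₁ ≠ m₂ →
      IsRepresentative !![l, 1; 0, l] !![m₁, 0; 0, m₂]
  | block_upper (l m z : K) : (m ≠ 0 ∨ z ≠ 0) →
      IsRepresentative !![l, 1; 0, l] !![m, z; 0, m]

/-- The table of images: `ImageTable A B W` says that the pair `(A, B)` of nonzero matrices
belongs to a row of the table whose last column is the subspace `W`. -/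
inductive ImageTable {K : Type*} [Field K] :
    Matrix (Fin 2) (Fin 2) K → Matrix (Fin 2) (Fin 2) K →
      Submodule K (Matrix (Fin 2) (Fin 2) K) → Prop
  | r1 (l x : K) : ImageTable !![l, 0; 0, l] !![x, 0; 0, x] ⊤
  | r2 (l x₁ x₂ : K) : x₁ ≠ x₂ → ImageTable !![l, 0; 0, l] !![x₁, 0; 0, x₂] ⊤
  | r3 (l x : K) : ImageTable !![l, 0; 0, l] !![x, 1; 0, x] ⊤
  | r4 (l m x : K) : l ≠ m → ImageTable !![l, 0; 0, m] !![x, 0; 0, x] ⊤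
  | r5 (l m x₁ x₂ : K) : l ≠ m → x₁ * x₂ ≠ 0 →
      ImageTable !![l, 0; 0, m] !![x₁, 0; 0, x₂] ⊤
  | r6 (l m x₁ x₂ : K) : l ≠ 0 → x₂ ≠ 0 → ImageTable !![l, 0; 0, m] !![x₁, 0; 0, x₂] ⊤
  | r7 (l m x₁ x₂ : K) : m ≠ 0 → x₁ ≠ 0 → ImageTable !![l, 0; 0, m] !![x₁, 0; 0, x₂] ⊤
  | r8 (l x : K) : ImageTable !![l, 0; 0, 0] !![x, 0; 0, 0] (rowSubspace K 0)
  | r9 (m x : K) : ImageTable !![0, 0; 0, m] !![0, 0; 0, x] (rowSubspace K 1)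
  | r10 (l m x : K) : l * m ≠ 0 → ImageTable !![l, 0; 0, m] !![x, 1; 0, x] ⊤
  | r11 (l m x : K) : l * m = 0 → x ≠ 0 → ImageTable !![l, 0; 0, m] !![x, 1; 0, x] ⊤
  | r12 (l m : K) : m ≠ 0 → ImageTable !![l, 0; 0, m] !![0, 1; 0, 0] ⊤
  | r13 (l : K) : ImageTable !![l, 0; 0, 0] !![0, 1; 0, 0] (rowSubspace K 0)
  | r14 (l m x₁ x₂ : K) : l * m ≠ 0 → x₁ ≠ x₂ →
      ImageTable !![l, 0; 0, m] !![x₁, 1; 0, x₂] ⊤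
  | r15 (l m x₁ x₂ : K) : l * m = 0 → x₁ * x₂ ≠ 0 →
      ImageTable !![l, 0; 0, m] !![x₁, 1; 0, x₂] ⊤
  | r16 (l m x : K) : m ≠ 0 → ImageTable !![l, 0; 0, m] !![x, 1; 0, 0] ⊤
  | r17 (l x : K) : ImageTable !![l, 0; 0, 0] !![x, 1; 0, 0] (rowSubspace K 0)
  | r18 (l x : K) : x ≠ 0 → ImageTable !![l, 0; 0, 0] !![0, 1; 0, x] ⊤
  | r19 (m x : K) : ImageTable !![0, 0; 0, m] !![0, 1; 0, x] ⊤
  | r20 (l m x : K) : l * m ≠ 0 → ImageTable !![l, 0; 0, m] !![x, 0; 1, x] ⊤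
  | r21 (l m x : K) : l * m = 0 → x ≠ 0 → ImageTable !![l, 0; 0, m] !![x, 0; 1, x] ⊤
  | r22 (l m : K) : l ≠ 0 → ImageTable !![l, 0; 0, m] !![0, 0; 1, 0] ⊤
  | r23 (m : K) : ImageTable !![0, 0; 0, m] !![0, 0; 1, 0] (rowSubspace K 1)
  | r24 (l m x₁ x₂ : K) : l * m ≠ 0 → x₁ ≠ x₂ →
      ImageTable !![l, 0; 0, m] !![x₁, 0; 1, x₂] ⊤
  | r25 (l m x₁ x₂ : K) : l * m = 0 → x₁ * x₂ ≠ 0 →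
      ImageTable !![l, 0; 0, m] !![x₁, 0; 1, x₂] ⊤
  | r26 (l x₁ x₂ : K) : ImageTable !![l, 0; 0, 0] !![x₁, 0; 1, x₂] ⊤
  | r27 (m x₁ x₂ : K) : x₁ ≠ 0 → ImageTable !![0, 0; 0, m] !![x₁, 0; 1, x₂] ⊤
  | r28 (m x : K) : ImageTable !![0, 0; 0, m] !![0, 0; 1, x] (rowSubspace K 1)
  | r29 (l m x₁ x₂ x₃ : K) : l ≠ m → x₁ ≠ 0 → x₂ ≠ 0 → x₃ ≠ 0 →
      ImageTable !![l, 0; 0, m] !![x₁, x₂; 1, x₃] ⊤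
  | r30 (l m x₂ x₃ : K) : l * m ≠ 0 → x₃ ≠ 0 →
      ImageTable !![l, 0; 0, m] !![0, x₂; 1, x₃] ⊤
  | r31 (l m x₂ x₃ : K) : x₂ ≠ 0 → x₃ ≠ 0 →
      ImageTable !![l, 0; 0, m] !![0, x₂; 1, x₃] ⊤
  | r32 (l m x₁ x₂ : K) : l ≠ m → x₁ ≠ 0 →
      ImageTable !![l, 0; 0, m] !![x₁, x₂; 1, 0] ⊤
  | r33 (l m x : K) : l ≠ m → x ≠ 0 → ImageTable !![l, 0; 0, m] !![0, x; 1, 0] ⊤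
  | r34 (l x z : K) : l ≠ 0 → x * z ≠ 0 → ImageTable !![l, 1; 0, l] !![x, 0; z, x] ⊤
  | r35 (x₁ x₂ z : K) : x₁ ≠ x₂ → z ≠ 0 → ImageTable !![0, 1; 0, 0] !![x₁, 0; z, x₂] ⊤
  | r36 (l x₁ x₂ : K) : l ≠ 0 → x₁ ≠ x₂ → ImageTable !![l, 1; 0, l] !![x₁, 0; 0, x₂] ⊤
  | r37 (z : K) : ImageTable !![0, 1; 0, 0] !![0, z; 0, 0] (rowSubspace K 0)
  | r38 (l x z : K) : x ≠ 0 → ImageTable !![l, 1; 0, l] !![x, z; 0, x] ⊤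
  -- the remaining representatives with a Jordan block as first matrix
  | r39 (l x₁ x₂ z : K) : z ≠ 0 → ImageTable !![l, 1; 0, l] !![x₁, 0; z, x₂] ⊤
  | r40 (x₁ x₂ : K) : x₂ ≠ 0 → x₁ ≠ x₂ → ImageTable !![0, 1; 0, 0] !![x₁, 0; 0, x₂] ⊤
  | r41 (x : K) : ImageTable !![0, 1; 0, 0] !![x, 0; 0, 0] (rowSubspace K 0)
  | r42 (l z : K) : l ≠ 0 → ImageTable !![l, 1; 0, l] !![0, z; 0, 0] ⊤

/-!
The image of `(X, Y) ↦ A X ^ k₁ + B Y ^ k₂` is as large as linear algebra permits: a row vector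
killing `A` and `B` kills every value, and conversely every matrix killed by all such row vectors
is a value (`range_powerSumMap`). In other words, the image consists of the matrices whose columns
lie in the sum of the column spaces of `A` and `B`; for nonzero `A` and `B` this is everything or a
subspace conjugate to that of the matrices with a fixed zero row.

The source of values is that over an algebraically closed field a matrix with two distinct
eigenvalues is diagonalizable, hence a `k`-th power for every `k > 0`
(`exists_pow_eq_of_charDisc_ne_zero`). If `A` is invertible, one needs a `Y ^ k₂` for which
`A⁻¹ (C - B Y ^ k₂)` has distinct eigenvalues. A rank one perturbation separates eigenvalues
(`exists_charDisc_sub_vecMulVec_ne_zero`), and since discriminants are polynomial along a line and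
the field is infinite, this and the distinctness of the eigenvalues of `Y ^ k₂` can be achieved
together. If both `A = u a` and `B = v b` have rank one, one needs `a X ^ k₁` and `b Y ^ k₂` to be
arbitrary rows, which the same perturbation argument gives (`exists_vecMul_pow_eq`).

Each row of the table then reduces to computing the row vectors that kill both matrices. The
reduction to representatives is Jordan form for `A` followed by normalizing `B` under shears and
diagonal matrices commuting with it. The surjectivity criterion is read off from the table, because
surjectivity is invariant under simultaneous conjugation.
-/

/-! ### Conjugation of two by two matrices -/

section Conjugation

variable {K : Type*} [Field K]

theorem conjBy_eq_of_mul_eq (P : GL (Fin 2) K) {A A' : Matrix (Fin 2) (Fin 2) K}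
    (h : (P : Matrix (Fin 2) (Fin 2) K) * A = A' * (P : Matrix (Fin 2) (Fin 2) K)) :
    conjBy P A = A' := by
  rw [conjBy, h, Matrix.mul_assoc, ← Units.val_mul, mul_inv_cancel, Units.val_one,
    Matrix.mul_one]

theorem conjBy_mul (P Q : GL (Fin 2) K) (A : Matrix (Fin 2) (Fin 2) K) :
    conjBy (P * Q) A = conjBy P (conjBy Q A) := by
  simp only [conjBy, _root_.mul_inv_rev, Units.val_mul, Matrix.mul_assoc]

theorem conjBy_one (A : Matrix (Fin 2) (Fin 2) K) : conjBy 1 A = A :=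
  conjBy_eq_of_mul_eq 1 (by simp)

theorem conjBy_inv_conjBy (P : GL (Fin 2) K) (A : Matrix (Fin 2) (Fin 2) K) :
    conjBy P⁻¹ (conjBy P A) = A := by
  rw [← conjBy_mul, inv_mul_cancel, conjBy_one]

theorem conjBy_conjBy_inv (P : GL (Fin 2) K) (A : Matrix (Fin 2) (Fin 2) K) :
    conjBy P (conjBy P⁻¹ A) = A := by
  rw [← conjBy_mul, mul_inv_cancel, conjBy_one]

theorem conjBy_pow (P : GL (Fin 2) K) (A : Matrix (Fin 2) (Fin 2) K) (k : ℕ) :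
    conjBy P (A ^ k) = conjBy P A ^ k :=
  (Units.conj_pow P A k).symm

theorem conjBy_powerSumMap (P : GL (Fin 2) K) (A B : Matrix (Fin 2) (Fin 2) K) (k₁ k₂ : ℕ)
    (X Y : Matrix (Fin 2) (Fin 2) K) :
    conjBy P (powerSumMap A B k₁ k₂ (X, Y)) =
      powerSumMap (conjBy P A) (conjBy P B) k₁ k₂ (conjBy P X, conjBy P Y) := by
  have hmul (C D : Matrix (Fin 2) (Fin 2) K) :
      conjBy P (C * D) = conjBy P C * conjBy P D := by
    simp [conjBy, Matrix.mul_assoc]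
  simp only [powerSumMap, ← conjBy_pow, ← hmul]
  simp only [conjBy, Matrix.mul_add, Matrix.add_mul]

theorem conjBy_ne_zero (P : GL (Fin 2) K) {A : Matrix (Fin 2) (Fin 2) K} (hA : A ≠ 0) :
    conjBy P A ≠ 0 := by
  intro h
  apply hA
  rw [← conjBy_inv_conjBy P A, h]
  simp [conjBy]

theorem surjective_powerSumMap_conjBy_iff (P : GL (Fin 2) K) (A B : Matrix (Fin 2) (Fin 2) K)
    (k₁ k₂ : ℕ) :
    Function.Surjective (powerSumMap (conjBy P A) (conjBy P B) k₁ k₂) ↔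
      Function.Surjective (powerSumMap A B k₁ k₂) := by
  refine ⟨fun h C => ?_, fun h C => ?_⟩
  · obtain ⟨⟨X, Y⟩, hXY⟩ := h (conjBy P C)
    refine ⟨(conjBy P⁻¹ X, conjBy P⁻¹ Y), ?_⟩
    rw [← conjBy_inv_conjBy P C, ← hXY, conjBy_powerSumMap, conjBy_inv_conjBy,
      conjBy_inv_conjBy]
  · obtain ⟨⟨X, Y⟩, hXY⟩ := h (conjBy P⁻¹ C)
    exact ⟨(conjBy P X, conjBy P Y), by
      rw [← conjBy_powerSumMap, hXY, conjBy_conjBy_inv]⟩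

theorem exists_conjBy_upper_shear (a b c d t : K) : ∃ P : GL (Fin 2) K,
    (∀ l m, conjBy P !![l, m; 0, l] = !![l, m; 0, l]) ∧
    conjBy P !![a, b; c, d] = !![a + t * c, b + t * (d - a) - t ^ 2 * c; c, d - t * c] := by
  refine ⟨GeneralLinearGroup.mkOfDetNeZero !![1, t; 0, 1] (by simp), fun l m => ?_, ?_⟩ <;>
  · apply conjBy_eq_of_mul_eq
    ext i j
    fin_cases i <;> fin_cases j <;>
      simp [GeneralLinearGroup.mkOfDetNeZero, Matrix.mul_apply, Fin.sum_univ_two] <;> ring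

theorem exists_conjBy_lower_shear (a b c d t : K) : ∃ P : GL (Fin 2) K,
    conjBy P !![a, b; c, d] = !![a - t * b, b; c + t * (a - d) - t ^ 2 * b, d + t * b] := by
  refine ⟨GeneralLinearGroup.mkOfDetNeZero !![1, 0; t, 1] (by simp), ?_⟩
  apply conjBy_eq_of_mul_eq
  ext i j
  fin_cases i <;> fin_cases j <;>
    simp [GeneralLinearGroup.mkOfDetNeZero, Matrix.mul_apply, Fin.sum_univ_two] <;> ring

theorem exists_conjBy_swap (a b c d : K) : ∃ P : GL (Fin 2) K,
    conjBy P !![a, b; c, d] = !![d, c; b, a] := by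
  refine ⟨GeneralLinearGroup.mkOfDetNeZero !![0, 1; 1, 0] (by simp), ?_⟩
  apply conjBy_eq_of_mul_eq
  ext i j
  fin_cases i <;> fin_cases j <;>
    simp [GeneralLinearGroup.mkOfDetNeZero, Matrix.mul_apply, Fin.sum_univ_two]

theorem exists_conjBy_scale (a b c d : K) {t : K} (ht : t ≠ 0) : ∃ P : GL (Fin 2) K,
    (∀ l m, conjBy P !![l, 0; 0, m] = !![l, 0; 0, m]) ∧
    conjBy P !![a, b; c, d] = !![a, t * b; t⁻¹ * c, d] := by
  refine ⟨GeneralLinearGroup.mkOfDetNeZero !![t, 0; 0, 1] (by simp [ht]), fun l m => ?_, ?_⟩ <;>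
  · apply conjBy_eq_of_mul_eq
    ext i j
    fin_cases i <;> fin_cases j <;>
      simp [GeneralLinearGroup.mkOfDetNeZero, Matrix.mul_apply, Fin.sum_univ_two, mul_comm, ht]

theorem conjBy_scalar (P : GL (Fin 2) K) (l : K) :
    conjBy P !![l, 0; 0, l] = !![l, 0; 0, l] := by
  apply conjBy_eq_of_mul_eq
  ext i j
  fin_cases i <;> fin_cases j <;> simp [Matrix.mul_apply, Fin.sum_univ_two, mul_comm]

end Conjugation

/-! ### Jordan form and representatives -/

section Representatives

variable {K : Type*} [Field K]

/-- Once the first matrix is diagonal with distinct entries, a diagonal conjugation normalizes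
an off-diagonal entry of the second one to `1`. -/
theorem exists_isRepresentative_of_diag {l m : K} (hlm : l ≠ m)
    {B : Matrix (Fin 2) (Fin 2) K} (hB : B ≠ 0) :
    ∃ P : GL (Fin 2) K, IsRepresentative (conjBy P !![l, 0; 0, m]) (conjBy P B) := by
  obtain ⟨a, b, c, d, rfl⟩ : ∃ a b c d, B = !![a, b; c, d] := ⟨_, _, _, _, Matrix.eta_fin_two B⟩
  by_cases hc : c = 0
  · subst hc
    by_cases hb : b = 0
    · subst hb
      refine ⟨1, ?_⟩
      rw [conjBy_one, conjBy_one]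
      by_cases had : a = d
      · subst had
        refine .diag_scalar _ _ _ hlm fun h => hB ?_
        subst h
        ext i j
        fin_cases i <;> fin_cases j <;> rfl
      · exact .diag_diag _ _ _ _ hlm had
    · obtain ⟨P, hP, hPB⟩ := exists_conjBy_scale a b 0 d (inv_ne_zero hb)
      refine ⟨P, ?_⟩
      rw [hP, hPB, inv_mul_cancel₀ hb, mul_zero]
      by_cases had : a = d
      · subst had
        exact .diag_upper_eq _ _ _ hlm
      · exact .diag_upper_ne _ _ _ _ hlm had
  · obtain ⟨P, hP, hPB⟩ := exists_conjBy_scale a b c d hc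
    refine ⟨P, ?_⟩
    rw [hP, hPB, inv_mul_cancel₀ hc]
    generalize c * b = x
    by_cases ha : a = 0
    · subst ha
      by_cases hd : d = 0
      · subst hd
        by_cases hx : x = 0
        · subst hx
          exact .diag_lower_eq _ _ _ hlm
        · exact .diag_anti _ _ _ hlm hx
      · exact .diag_zero_left _ _ _ _ hlm hd
    · by_cases hd : d = 0
      · subst hd
        exact .diag_zero_right _ _ _ _ hlm ha
      · by_cases hx : x = 0
        · subst hx
          by_cases had : a = d
          · subst had
            exact .diag_lower_eq _ _ _ hlm
          · exact .diag_lower_ne _ _ _ _ hlm had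
        · exact .diag_full _ _ _ _ _ hlm ha hx hd

variable [IsAlgClosed K]

theorem exists_add_mul_sub_sq_mul_eq_zero (b e : K) {c : K} (hc : c ≠ 0) :
    ∃ t : K, b + t * e - t ^ 2 * c = 0 := by
  obtain ⟨t, ht⟩ := IsAlgClosed.exists_root
    (Polynomial.C (-c) * Polynomial.X ^ 2 + Polynomial.C e * Polynomial.X + Polynomial.C b)
    (by rw [Polynomial.degree_quadratic (neg_ne_zero.mpr hc)]; decide)
  refine ⟨t, ?_⟩
  simp only [Polynomial.IsRoot.def, Polynomial.eval_add, Polynomial.eval_mul, Polynomial.eval_C,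
    Polynomial.eval_pow, Polynomial.eval_X] at ht
  linear_combination ht

theorem exists_conjBy_upper_triangular (A : Matrix (Fin 2) (Fin 2) K) :
    ∃ (P : GL (Fin 2) K) (a b d : K), conjBy P A = !![a, b; 0, d] := by
  rw [Matrix.eta_fin_two A]
  by_cases hb : A 0 1 = 0
  · obtain ⟨P, hP⟩ := exists_conjBy_swap (A 0 0) (A 0 1) (A 1 0) (A 1 1)
    rw [hb] at hP
    exact ⟨P, _, _, _, by rw [hb]; exact hP⟩
  · obtain ⟨t, ht⟩ := exists_add_mul_sub_sq_mul_eq_zero (A 1 0) (A 0 0 - A 1 1) hb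
    obtain ⟨P, hP⟩ := exists_conjBy_lower_shear (A 0 0) (A 0 1) (A 1 0) (A 1 1) t
    exact ⟨P, _, _, _, by rw [hP, ht]⟩

/-- Jordan normal form of a two by two matrix. -/
theorem exists_conjBy_jordan (A : Matrix (Fin 2) (Fin 2) K) : ∃ P : GL (Fin 2) K,
    (∃ l, conjBy P A = !![l, 0; 0, l]) ∨ (∃ l m, l ≠ m ∧ conjBy P A = !![l, 0; 0, m]) ∨
      ∃ l, conjBy P A = !![l, 1; 0, l] := by
  obtain ⟨P, a, b, d, hP⟩ := exists_conjBy_upper_triangular A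
  by_cases had : a = d
  · subst had
    by_cases hb : b = 0
    · exact ⟨P, Or.inl ⟨a, by rw [hP, hb]⟩⟩
    · obtain ⟨Q, -, hQ⟩ := exists_conjBy_scale a b 0 a (inv_ne_zero hb)
      refine ⟨Q * P, Or.inr (Or.inr ⟨a, ?_⟩)⟩
      rw [conjBy_mul, hP, hQ, inv_mul_cancel₀ hb, mul_zero]
  · obtain ⟨Q, -, hQ⟩ := exists_conjBy_upper_shear a b 0 d (b / (a - d))
    refine ⟨Q * P, Or.inr (Or.inl ⟨a, d, had, ?_⟩)⟩
    have h : b + b / (a - d) * (d - a) = 0 := by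
      field_simp [sub_ne_zero.mpr had]
      ring
    rw [conjBy_mul, hP, hQ]
    simp [h]

/-- The centralizer of a Jordan block contains the upper shears, which suffice to normalize the
second matrix. -/
theorem exists_isRepresentative_of_block (l : K) {B : Matrix (Fin 2) (Fin 2) K} (hB : B ≠ 0) :
    ∃ P : GL (Fin 2) K, IsRepresentative (conjBy P !![l, 1; 0, l]) (conjBy P B) := by
  obtain ⟨a, b, c, d, rfl⟩ : ∃ a b c d, B = !![a, b; c, d] := ⟨_, _, _, _, Matrix.eta_fin_two B⟩
  by_cases hc : c = 0
  · subst hc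
    by_cases had : a = d
    · subst had
      refine ⟨1, ?_⟩
      rw [conjBy_one, conjBy_one]
      refine .block_upper _ _ _ ?_
      by_contra! h
      obtain ⟨rfl, rfl⟩ := h
      apply hB
      ext i j
      fin_cases i <;> fin_cases j <;> rfl
    · obtain ⟨P, hP, hPB⟩ := exists_conjBy_upper_shear a b 0 d (b / (a - d))
      have h : b + b / (a - d) * (d - a) = 0 := by
        field_simp [sub_ne_zero.mpr had]
        ring
      refine ⟨P, ?_⟩
      rw [hP, hPB]
      simp only [h, mul_zero, sub_zero, add_zero]
      exact .block_diag _ _ _ had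
  · obtain ⟨t, ht⟩ := exists_add_mul_sub_sq_mul_eq_zero b (d - a) hc
    obtain ⟨P, hP, hPB⟩ := exists_conjBy_upper_shear a b c d t
    refine ⟨P, ?_⟩
    rw [hP, hPB, ht]
    exact .block_lower _ _ _ _ hc

theorem exists_conjBy_isRepresentative {A B : Matrix (Fin 2) (Fin 2) K} (hA : A ≠ 0)
    (hB : B ≠ 0) : ∃ P : GL (Fin 2) K, IsRepresentative (conjBy P A) (conjBy P B) := by
  obtain ⟨P, ⟨l, hP⟩ | ⟨l, m, hlm, hP⟩ | ⟨l, hP⟩⟩ := exists_conjBy_jordan A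
  · have hl : l ≠ 0 := by
      rintro rfl
      apply conjBy_ne_zero P hA
      rw [hP]
      ext i j
      fin_cases i <;> fin_cases j <;> rfl
    obtain ⟨Q, hQ⟩ := exists_conjBy_jordan (conjBy P B)
    refine ⟨Q * P, ?_⟩
    rw [conjBy_mul, conjBy_mul, hP, conjBy_scalar]
    obtain ⟨m, hQ⟩ | ⟨m₁, m₂, hm, hQ⟩ | ⟨m, hQ⟩ := hQ
    · rw [hQ]
      refine .scalar_scalar _ _ hl ?_
      rintro rfl
      apply conjBy_ne_zero Q (conjBy_ne_zero P hB)
      rw [hQ]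
      ext i j
      fin_cases i <;> fin_cases j <;> rfl
    · rw [hQ]
      exact .scalar_diag _ _ _ hl hm
    · rw [hQ]
      exact .scalar_block _ _ hl
  · obtain ⟨Q, hQ⟩ := exists_isRepresentative_of_diag hlm (conjBy_ne_zero P hB)
    exact ⟨Q * P, by rwa [conjBy_mul, conjBy_mul, hP]⟩
  · obtain ⟨Q, hQ⟩ := exists_isRepresentative_of_block l (conjBy_ne_zero P hB)
    exact ⟨Q * P, by rwa [conjBy_mul, conjBy_mul, hP]⟩

end Representatives

/-! ### Powers and the discriminant of the characteristic polynomial -/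

section Powers

variable {K : Type*} [Field K]

/-- The discriminant of the characteristic polynomial of a two by two matrix, that is the square
of the difference of the eigenvalues. This form of it is correct in every characteristic. -/
def charDisc (M : Matrix (Fin 2) (Fin 2) K) : K :=
  M.trace ^ 2 - 4 * M.det

theorem charDisc_eq (M : Matrix (Fin 2) (Fin 2) K) :
    charDisc M = (M 0 0 - M 1 1) ^ 2 + 4 * (M 0 1 * M 1 0) := by
  rw [charDisc, Matrix.trace_fin_two, Matrix.det_fin_two]
  ring

theorem charDisc_conjBy (P : GL (Fin 2) K) (M : Matrix (Fin 2) (Fin 2) K) :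
    charDisc (conjBy P M) = charDisc M := by
  rw [charDisc, charDisc, conjBy, Matrix.trace_units_conj, Matrix.det_units_conj]

theorem exists_pow_eq_of_charDisc_ne_zero [IsAlgClosed K] {k : ℕ} (hk : 0 < k)
    {M : Matrix (Fin 2) (Fin 2) K} (hM : charDisc M ≠ 0) :
    ∃ X : Matrix (Fin 2) (Fin 2) K, X ^ k = M := by
  obtain ⟨P, hP⟩ := exists_conjBy_jordan M
  suffices h : ∃ l m, conjBy P M = Matrix.diagonal ![l, m] by
    obtain ⟨l, m, h⟩ := h
    obtain ⟨x, hx⟩ := IsAlgClosed.exists_pow_nat_eq l hk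
    obtain ⟨y, hy⟩ := IsAlgClosed.exists_pow_nat_eq m hk
    refine ⟨conjBy P⁻¹ (Matrix.diagonal ![x, y]), ?_⟩
    rw [← conjBy_pow, Matrix.diagonal_pow, ← conjBy_inv_conjBy P M, h]
    congr 2
    ext i
    fin_cases i <;> simp [hx, hy]
  obtain ⟨l, hP⟩ | ⟨l, m, -, hP⟩ | ⟨l, hP⟩ := hP
  · refine ⟨l, l, ?_⟩
    rw [hP]
    ext i j
    fin_cases i <;> fin_cases j <;> rfl
  · refine ⟨l, m, ?_⟩
    rw [hP]
    ext i j
    fin_cases i <;> fin_cases j <;> rfl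
  · rw [← charDisc_conjBy P, hP, charDisc_eq] at hM
    simp at hM

/-- A rank one perturbation with prescribed nonzero column vector can separate the eigenvalues
of any matrix. -/
theorem exists_charDisc_sub_vecMulVec_ne_zero (E : Matrix (Fin 2) (Fin 2) K) {u : Fin 2 → K}
    (hu : u ≠ 0) : ∃ z : Fin 2 → K, charDisc (E - vecMulVec u z) ≠ 0 := by
  -- For a row `w` with `w u = 1`, the choice `z = w E - p w` makes `w` a left eigenvector with
  -- eigenvalue `p`; the other eigenvalue is `tr E - w E u`, and `p` is that number plus `1`.
  obtain ⟨w, hw⟩ : ∃ w : Fin 2 → K, w 0 * u 0 + w 1 * u 1 = 1 := by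
    by_cases h0 : u 0 = 0
    · have h1 : u 1 ≠ 0 := by
        intro h1
        apply hu
        ext i
        fin_cases i
        exacts [h0, h1]
      exact ⟨![0, (u 1)⁻¹], by simp [h1]⟩
    · exact ⟨![(u 0)⁻¹, 0], by simp [h0]⟩
  set p : K := E 0 0 + E 1 1 - (w 0 * (E 0 0 * u 0 + E 0 1 * u 1) +
    w 1 * (E 1 0 * u 0 + E 1 1 * u 1)) + 1 with hp
  refine ⟨![w 0 * E 0 0 + w 1 * E 1 0 - p * w 0, w 0 * E 0 1 + w 1 * E 1 1 - p * w 1], ?_⟩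
  suffices h : charDisc (E - vecMulVec u
      ![w 0 * E 0 0 + w 1 * E 1 0 - p * w 0, w 0 * E 0 1 + w 1 * E 1 1 - p * w 1]) = 1 by
    rw [h]
    exact one_ne_zero
  have ht : (E - vecMulVec u ![w 0 * E 0 0 + w 1 * E 1 0 - p * w 0,
      w 0 * E 0 1 + w 1 * E 1 1 - p * w 1]).trace = p + (p - 1) := by
    simp only [Matrix.trace_fin_two, Matrix.sub_apply, Matrix.vecMulVec_apply, Matrix.cons_val_zero,
      Matrix.cons_val_one]
    linear_combination p * hw - hp
  have hd : (E - vecMulVec u ![w 0 * E 0 0 + w 1 * E 1 0 - p * w 0,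
      w 0 * E 0 1 + w 1 * E 1 1 - p * w 1]).det = p * (p - 1) := by
    simp only [Matrix.det_fin_two, Matrix.sub_apply, Matrix.vecMulVec_apply, Matrix.cons_val_zero,
      Matrix.cons_val_one]
    have hq : p - 1 = E 0 0 + E 1 1 - (w 0 * (E 0 0 * u 0 + E 0 1 * u 1) +
      w 1 * (E 1 0 * u 0 + E 1 1 * u 1)) := by rw [hp]; ring
    rw [hq]
    linear_combination (-(E 0 0 * E 1 1 - E 0 1 * E 1 0) + p * (E 0 0 + E 1 1)) * hw
  rw [charDisc, ht, hd]
  ring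

/-- Over an infinite field, if some value of `E - D Z` has distinct eigenvalues, then `Z` can be
chosen to have distinct eigenvalues as well. -/
theorem exists_charDisc_ne_zero_and [Infinite K] (E D : Matrix (Fin 2) (Fin 2) K)
    {Z₁ : Matrix (Fin 2) (Fin 2) K} (hZ₁ : charDisc (E - D * Z₁) ≠ 0) :
    ∃ Z : Matrix (Fin 2) (Fin 2) K, charDisc Z ≠ 0 ∧ charDisc (E - D * Z) ≠ 0 := by
  -- Along a line of matrices the discriminant is a polynomial function of the parameter.
  have key (M N : Matrix (Fin 2) (Fin 2) K) :
      ∃ p : Polynomial K, ∀ t, p.eval t = charDisc (M + t • N) := by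
    let e (i j : Fin 2) : Polynomial K := Polynomial.C (M i j) + Polynomial.C (N i j) * Polynomial.X
    refine ⟨(e 0 0 - e 1 1) ^ 2 + 4 * (e 0 1 * e 1 0), fun t => ?_⟩
    simp [e, charDisc_eq, mul_comm t]
  let Z₀ : Matrix (Fin 2) (Fin 2) K := !![1, 0; 0, 0]
  have hZ₀ : charDisc Z₀ ≠ 0 := by simp [charDisc_eq, Z₀]
  obtain ⟨p, hp⟩ := key Z₀ (Z₁ - Z₀)
  obtain ⟨q, hq⟩ := key (E - D * Z₀) (-(D * (Z₁ - Z₀)))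
  have hp0 : p ≠ 0 := by
    rintro rfl
    apply hZ₀
    simpa using (hp 0).symm
  have hq0 : q ≠ 0 := by
    rintro rfl
    apply hZ₁
    have h := (hq 1).symm
    rw [Polynomial.eval_zero] at h
    rw [← h]
    congr 1
    rw [one_smul, Matrix.mul_sub]
    abel
  obtain ⟨t, ht⟩ : ∃ t, (p * q).eval t ≠ 0 := by
    by_contra! h
    exact mul_ne_zero hp0 hq0 (Polynomial.funext fun t => by rw [h t, Polynomial.eval_zero])
  rw [Polynomial.eval_mul, hp, hq] at ht
  refine ⟨Z₀ + t • (Z₁ - Z₀), left_ne_zero_of_mul ht, ?_⟩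
  convert right_ne_zero_of_mul ht using 2
  rw [Matrix.mul_add, Matrix.mul_smul, smul_neg]
  abel

/-- A nonzero row vector is moved to any given row vector by some `k`-th power. -/
theorem exists_vecMul_pow_eq [IsAlgClosed K] {k : ℕ} (hk : 0 < k) {a : Fin 2 → K} (ha : a ≠ 0)
    (c : Fin 2 → K) : ∃ X : Matrix (Fin 2) (Fin 2) K, a ᵥ* X ^ k = c := by
  obtain ⟨w, hw⟩ : ∃ w : Fin 2 → K, a ⬝ᵥ w = 1 := by
    obtain ⟨i, hi⟩ := Function.ne_iff.mp ha
    exact ⟨Pi.single i (a i)⁻¹, by simpa using mul_inv_cancel₀ hi⟩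
  -- `w c` maps `a` to `c`, and so does its sum with any `u z` for `u` orthogonal to `a`.
  have hu : ![-a 1, a 0] ≠ 0 := by
    intro h
    apply ha
    ext i
    fin_cases i
    · simpa using congrFun h 1
    · simpa using congrFun h 0
  have hau : a ⬝ᵥ ![-a 1, a 0] = 0 := by
    simp only [dotProduct, Fin.sum_univ_two, Matrix.cons_val_zero, Matrix.cons_val_one]
    ring
  obtain ⟨z, hz⟩ := exists_charDisc_sub_vecMulVec_ne_zero (vecMulVec w c) hu
  obtain ⟨X, hX⟩ := exists_pow_eq_of_charDisc_ne_zero hk hz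
  refine ⟨X, ?_⟩
  rw [hX, Matrix.vecMul_sub, Matrix.vecMul_vecMulVec, Matrix.vecMul_vecMulVec, hw, hau]
  simp

theorem exists_eq_vecMulVec_of_det_eq_zero {A : Matrix (Fin 2) (Fin 2) K} (hA : A ≠ 0)
    (hdet : A.det = 0) : ∃ u a : Fin 2 → K, u ≠ 0 ∧ a ≠ 0 ∧ A = vecMulVec u a := by
  suffices h : ∃ u a : Fin 2 → K, A = vecMulVec u a by
    obtain ⟨u, a, h⟩ := h
    refine ⟨u, a, ?_, ?_, h⟩ <;>
    · rintro rfl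
      apply hA
      simp [h]
  rw [Matrix.det_fin_two] at hdet
  by_cases h : A 0 = 0
  · refine ⟨![0, 1], A 1, ?_⟩
    ext i j
    fin_cases i
    · simpa [vecMulVec_apply] using congrFun h j
    · simp [vecMulVec_apply]
  · obtain ⟨j, hj⟩ := Function.ne_iff.mp h
    have hj' : A 0 j ≠ 0 := hj
    refine ⟨![1, A 1 j / A 0 j], A 0, ?_⟩
    ext i j'
    fin_cases i
    · simp [vecMulVec_apply]
    · have hminor : ∀ p q, A 1 q * A 0 p = A 1 p * A 0 q := by
        simp only [Fin.forall_fin_two]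
        refine ⟨⟨trivial, ?_⟩, ?_, trivial⟩
        · linear_combination hdet
        · linear_combination -hdet
      change A 1 j' = A 1 j / A 0 j * A 0 j'
      rw [div_mul_eq_mul_div, eq_div_iff hj', hminor]

end Powers

/-! ### The image of the map -/

section Image

variable {K : Type*} [Field K]

/-- The matrices killed by every row vector that kills both `A` and `B`, or equivalently those
whose columns lie in the sum of the column spaces of `A` and `B`. -/
def columnSpan (A B : Matrix (Fin 2) (Fin 2) K) :
    Submodule K (Matrix (Fin 2) (Fin 2) K) where
  carrier := {C | ∀ v : Fin 2 → K, v ᵥ* A = 0 → v ᵥ* B = 0 → v ᵥ* C = 0}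
  zero_mem' := fun v _ _ => Matrix.vecMul_zero v
  add_mem' := by
    intro C D hC hD v hA hB
    rw [Matrix.vecMul_add, hC v hA hB, hD v hA hB, add_zero]
  smul_mem' := by
    intro c C hC v hA hB
    rw [Matrix.vecMul_smul, hC v hA hB, smul_zero]

theorem range_powerSumMap_swap (A B : Matrix (Fin 2) (Fin 2) K) (k₁ k₂ : ℕ) :
    Set.range (powerSumMap A B k₁ k₂) = Set.range (powerSumMap B A k₂ k₁) := by
  ext C
  constructor <;>
  · rintro ⟨⟨X, Y⟩, h⟩
    exact ⟨(Y, X), by rw [← h]; exact add_comm _ _⟩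

variable [IsAlgClosed K]

/-- For invertible `A`, the matrix `Y ^ k₂` is chosen so that the forced value of `X ^ k₁` has
distinct eigenvalues. -/
theorem mem_range_powerSumMap_of_det_ne_zero {k₁ k₂ : ℕ} (hk₁ : 0 < k₁) (hk₂ : 0 < k₂)
    {A B : Matrix (Fin 2) (Fin 2) K} (hA : A.det ≠ 0) (hB : B ≠ 0)
    (C : Matrix (Fin 2) (Fin 2) K) : C ∈ Set.range (powerSumMap A B k₁ k₂) := by
  have hinv : A * A⁻¹ = 1 := Matrix.mul_nonsing_inv A (isUnit_iff_ne_zero.mpr hA)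
  set D := A⁻¹ * B with hD
  have hAD : A * D = B := by rw [hD, ← Matrix.mul_assoc, hinv, Matrix.one_mul]
  obtain ⟨j, hj⟩ : ∃ j, Dᵀ j ≠ 0 := by
    by_contra! h
    apply hB
    rw [← hAD, show D = 0 from by ext i j; exact congrFun (h j) i, Matrix.mul_zero]
  obtain ⟨z, hz⟩ := exists_charDisc_sub_vecMulVec_ne_zero (A⁻¹ * C) hj
  have hcol : vecMulVec (Dᵀ j) z = D * vecMulVec (Pi.single j 1) z := by
    rw [Matrix.mul_vecMulVec, Matrix.mulVec_single_one]
    rfl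
  rw [hcol] at hz
  have : Infinite K := IsAlgClosed.instInfinite
  obtain ⟨Z, hZ, hEZ⟩ := exists_charDisc_ne_zero_and _ _ hz
  obtain ⟨Y, hY⟩ := exists_pow_eq_of_charDisc_ne_zero hk₂ hZ
  obtain ⟨X, hX⟩ := exists_pow_eq_of_charDisc_ne_zero hk₁ hEZ
  refine ⟨(X, Y), ?_⟩
  rw [powerSumMap, hX, hY, Matrix.mul_sub, ← Matrix.mul_assoc, ← Matrix.mul_assoc, hinv, hAD,
    Matrix.one_mul, sub_add_cancel]

theorem range_powerSumMap {k₁ k₂ : ℕ} (hk₁ : 0 < k₁) (hk₂ : 0 < k₂)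
    {A B : Matrix (Fin 2) (Fin 2) K} (hA : A ≠ 0) (hB : B ≠ 0) :
    Set.range (powerSumMap A B k₁ k₂) = columnSpan A B := by
  apply Set.Subset.antisymm
  · rintro _ ⟨⟨X, Y⟩, rfl⟩ v hvA hvB
    rw [powerSumMap, Matrix.vecMul_add, ← Matrix.vecMul_vecMul, ← Matrix.vecMul_vecMul, hvA, hvB,
      Matrix.zero_vecMul, Matrix.zero_vecMul, add_zero]
  intro C hC
  by_cases hdA : A.det = 0
  swap
  · exact mem_range_powerSumMap_of_det_ne_zero hk₁ hk₂ hdA hB C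
  by_cases hdB : B.det = 0
  swap
  · rw [range_powerSumMap_swap]
    exact mem_range_powerSumMap_of_det_ne_zero hk₂ hk₁ hdB hA C
  obtain ⟨u, a, hu, ha, rfl⟩ := exists_eq_vecMulVec_of_det_eq_zero hA hdA
  obtain ⟨v, b, hv, hb, rfl⟩ := exists_eq_vecMulVec_of_det_eq_zero hB hdB
  -- Powers move the rows `a` and `b` anywhere, so `C` only has to be split along `u` and `v`.
  suffices h : ∃ c d, C = vecMulVec u c + vecMulVec v d by
    obtain ⟨c, d, rfl⟩ := h
    obtain ⟨X, hX⟩ := exists_vecMul_pow_eq hk₁ ha c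
    obtain ⟨Y, hY⟩ := exists_vecMul_pow_eq hk₂ hb d
    refine ⟨(X, Y), ?_⟩
    rw [powerSumMap, Matrix.vecMulVec_mul, Matrix.vecMulVec_mul, hX, hY]
  by_cases hδ : u 0 * v 1 - u 1 * v 0 = 0
  · have hw := hC ![-u 1, u 0]
      (by
        ext j
        simp [Matrix.vecMul_vecMulVec, dotProduct, Fin.sum_univ_two]
        grind)
      (by
        ext j
        simp [Matrix.vecMul_vecMulVec, dotProduct, Fin.sum_univ_two]
        grind)
    have hw' (j : Fin 2) : -u 1 * C 0 j + u 0 * C 1 j = 0 := by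
      simpa [Matrix.vecMul, dotProduct, Fin.sum_univ_two] using congrFun hw j
    obtain ⟨i, hi⟩ := Function.ne_iff.mp hu
    have hi' : u i ≠ 0 := hi
    refine ⟨fun j => C i j / u i, 0, ?_⟩
    ext i' j
    simp only [Matrix.vecMulVec_zero, add_zero, Matrix.vecMulVec_apply]
    have hminor : ∀ p q, C q j * u p = u q * C p j := by
      simp only [Fin.forall_fin_two]
      refine ⟨⟨mul_comm _ _, ?_⟩, ?_, mul_comm _ _⟩
      · linear_combination hw' j
      · linear_combination -hw' j
    rw [mul_div_assoc', eq_div_iff hi', hminor]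
  · refine ⟨fun j => (C 0 j * v 1 - C 1 j * v 0) / (u 0 * v 1 - u 1 * v 0),
      fun j => (u 0 * C 1 j - u 1 * C 0 j) / (u 0 * v 1 - u 1 * v 0), ?_⟩
    ext i j
    simp only [Matrix.add_apply, Matrix.vecMulVec_apply]
    rw [mul_div_assoc', mul_div_assoc', ← add_div, eq_div_iff hδ]
    revert i
    rw [Fin.forall_fin_two]
    constructor <;> ring

theorem range_powerSumMap_eq_top {k₁ k₂ : ℕ} (hk₁ : 0 < k₁) (hk₂ : 0 < k₂)
    {A B : Matrix (Fin 2) (Fin 2) K} (hA : A ≠ 0) (hB : B ≠ 0)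
    (h : ∀ x y : K, (∀ j, x * A 0 j + y * A 1 j = 0) → (∀ j, x * B 0 j + y * B 1 j = 0) →
      x = 0 ∧ y = 0) :
    Set.range (powerSumMap A B k₁ k₂) = (⊤ : Submodule K (Matrix (Fin 2) (Fin 2) K)) := by
  rw [range_powerSumMap hk₁ hk₂ hA hB]
  congr 1
  refine eq_top_iff.mpr fun C _ v hvA hvB => ?_
  obtain ⟨h0, h1⟩ := h (v 0) (v 1)
    (fun j => by simpa [Matrix.vecMul, dotProduct, Fin.sum_univ_two] using congrFun hvA j)
    (fun j => by simpa [Matrix.vecMul, dotProduct, Fin.sum_univ_two] using congrFun hvB j)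
  have hv : v = 0 := by
    ext i
    fin_cases i
    exacts [h0, h1]
  rw [hv, Matrix.zero_vecMul]

theorem range_powerSumMap_eq_rowSubspace {k₁ k₂ : ℕ} (hk₁ : 0 < k₁) (hk₂ : 0 < k₂)
    {A B : Matrix (Fin 2) (Fin 2) K} (hA : A ≠ 0) (hB : B ≠ 0) (i : Fin 2)
    (hAi : A ∈ rowSubspace K i) (hBi : B ∈ rowSubspace K i) :
    Set.range (powerSumMap A B k₁ k₂) = rowSubspace K i := by
  have hvec {C : Matrix (Fin 2) (Fin 2) K} (hC : C ∈ rowSubspace K i) (v : Fin 2 → K) :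
      v ᵥ* C = v i • C i := by
    ext j
    rw [Matrix.vecMul, dotProduct, Finset.sum_eq_single i]
    · rfl
    · intro i' _ hi'
      rw [hC i' hi' j, mul_zero]
    · simp
  rw [range_powerSumMap hk₁ hk₂ hA hB]
  congr 1
  ext C
  constructor
  · intro hC i' hi' j
    have hs : Pi.single (M := fun _ => K) i' 1 i = 0 := Pi.single_eq_of_ne hi'.symm 1
    have h := hC (Pi.single i' 1) (by rw [hvec hAi, hs, zero_smul])
      (by rw [hvec hBi, hs, zero_smul])
    rw [Matrix.single_one_vecMul] at h
    exact congrFun h j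
  · intro hC v hvA _
    rw [hvec hAi, smul_eq_zero] at hvA
    rw [hvec hC]
    obtain h | h := hvA
    · rw [h, zero_smul]
    · exfalso
      apply hA
      ext i' j
      by_cases hi : i' = i
      · rw [hi, h]
        rfl
      · exact hAi i' hi j

end Image

/-! ### The table of images -/

section Table

variable {K : Type*} [Field K]

theorem IsRepresentative.exists_imageTable {A B : Matrix (Fin 2) (Fin 2) K}
    (h : IsRepresentative A B) : ∃ W, ImageTable A B W := by
  cases h with
  | scalar_scalar l m hl hm => exact ⟨_, .r1 _ _⟩
  | scalar_diag l m₁ m₂ hl hm => exact ⟨_, .r2 _ _ _ hm⟩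
  | scalar_block l m hl => exact ⟨_, .r3 _ _⟩
  | diag_scalar l l' m hl hm => exact ⟨_, .r4 _ _ _ hl⟩
  | diag_diag l l' m₁ m₂ hl hm =>
    by_cases h₁ : l = 0
    · subst h₁
      by_cases h₂ : m₁ = 0
      · subst h₂
        exact ⟨_, .r9 _ _⟩
      · exact ⟨_, .r7 _ _ _ _ hl.symm h₂⟩
    · by_cases h₂ : m₂ = 0
      · subst h₂
        by_cases h₃ : l' = 0
        · subst h₃
          exact ⟨_, .r8 _ _⟩
        · exact ⟨_, .r7 _ _ _ _ h₃ hm⟩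
      · exact ⟨_, .r6 _ _ _ _ h₁ h₂⟩
  | diag_upper_eq l l' m hl =>
    by_cases h₁ : l * l' = 0
    · by_cases h₂ : m = 0
      · subst h₂
        by_cases h₃ : l' = 0
        · subst h₃
          exact ⟨_, .r13 _⟩
        · exact ⟨_, .r12 _ _ h₃⟩
      · exact ⟨_, .r11 _ _ _ h₁ h₂⟩
    · exact ⟨_, .r10 _ _ _ h₁⟩
  | diag_upper_ne l l' m₁ m₂ hl hm =>
    by_cases h₁ : l * l' = 0
    · by_cases h₂ : m₂ = 0
      · subst h₂
        by_cases h₃ : l' = 0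
        · subst h₃
          exact ⟨_, .r17 _ _⟩
        · exact ⟨_, .r16 _ _ _ h₃⟩
      · by_cases h₃ : m₁ = 0
        · subst h₃
          obtain rfl | rfl := mul_eq_zero.mp h₁
          · exact ⟨_, .r19 _ _⟩
          · exact ⟨_, .r18 _ _ h₂⟩
        · exact ⟨_, .r15 _ _ _ _ h₁ (mul_ne_zero h₃ h₂)⟩
    · exact ⟨_, .r14 _ _ _ _ h₁ hm⟩
  | diag_lower_eq l l' m hl =>
    by_cases h₁ : l * l' = 0
    · by_cases h₂ : m = 0
      · subst h₂
        by_cases h₃ : l = 0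
        · subst h₃
          exact ⟨_, .r23 _⟩
        · exact ⟨_, .r22 _ _ h₃⟩
      · exact ⟨_, .r21 _ _ _ h₁ h₂⟩
    · exact ⟨_, .r20 _ _ _ h₁⟩
  | diag_lower_ne l l' m₁ m₂ hl hm =>
    by_cases h₁ : l * l' = 0
    · obtain rfl | rfl := mul_eq_zero.mp h₁
      · by_cases h₂ : m₁ = 0
        · subst h₂
          exact ⟨_, .r28 _ _⟩
        · exact ⟨_, .r27 _ _ _ h₂⟩
      · exact ⟨_, .r26 _ _ _⟩
    · exact ⟨_, .r24 _ _ _ _ h₁ hm⟩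
  | diag_full l l' z₁ z₂ z₃ hl h₁ h₂ h₃ => exact ⟨_, .r29 _ _ _ _ _ hl h₁ h₂ h₃⟩
  | diag_zero_left l l' z₂ z₃ hl h₃ =>
    by_cases h₁ : l * l' = 0
    · by_cases h₂ : z₂ = 0
      · subst h₂
        obtain rfl | rfl := mul_eq_zero.mp h₁
        · exact ⟨_, .r28 _ _⟩
        · exact ⟨_, .r26 _ _ _⟩
      · exact ⟨_, .r31 _ _ _ _ h₂ h₃⟩
    · exact ⟨_, .r30 _ _ _ _ h₁ h₃⟩
  | diag_zero_right l l' z₁ z₂ hl h₁ => exact ⟨_, .r32 _ _ _ _ hl h₁⟩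
  | diag_anti l l' z₂ hl h₂ => exact ⟨_, .r33 _ _ _ hl h₂⟩
  | block_lower l m₁ m₂ z hz => exact ⟨_, .r39 _ _ _ _ hz⟩
  | block_diag l m₁ m₂ hm =>
    by_cases h₁ : l = 0
    · subst h₁
      by_cases h₂ : m₂ = 0
      · subst h₂
        exact ⟨_, .r41 _⟩
      · exact ⟨_, .r40 _ _ h₂ hm⟩
    · exact ⟨_, .r36 _ _ _ h₁ hm⟩
  | block_upper l m z h =>
    by_cases h₁ : m = 0
    · subst h₁
      by_cases h₂ : l = 0
      · subst h₂
        exact ⟨_, .r37 _⟩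
      · exact ⟨_, .r42 _ _ h₂⟩
    · exact ⟨_, .r38 _ _ _ h₁⟩

theorem ImageTable.eq_top_or_eq_rowSubspace {A B : Matrix (Fin 2) (Fin 2) K}
    {W : Submodule K (Matrix (Fin 2) (Fin 2) K)} (h : ImageTable A B W) :
    W = ⊤ ∨ ∃ i, W = rowSubspace K i := by
  cases h
  all_goals first
    | exact Or.inl rfl
    | exact Or.inr ⟨_, rfl⟩

theorem ne_zero_iff_entries (a b c d : K) :
    !![a, b; c, d] ≠ 0 ↔ a ≠ 0 ∨ b ≠ 0 ∨ c ≠ 0 ∨ d ≠ 0 := by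
  rw [Ne, ← Matrix.ext_iff]
  simp [Fin.forall_fin_two]
  tauto

theorem ImageTable.range_powerSumMap [IsAlgClosed K] {k₁ k₂ : ℕ} (hk₁ : 0 < k₁) (hk₂ : 0 < k₂)
    {A B : Matrix (Fin 2) (Fin 2) K} (hA : A ≠ 0) (hB : B ≠ 0)
    {W : Submodule K (Matrix (Fin 2) (Fin 2) K)} (h : ImageTable A B W) :
    Set.range (powerSumMap A B k₁ k₂) = W := by
  cases h
  all_goals first
    | refine range_powerSumMap_eq_top hk₁ hk₂ hA hB fun x y hxA hxB => ?_
      rw [ne_zero_iff_entries] at hA hB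
      simp only [Fin.forall_fin_two, Matrix.of_apply, Matrix.cons_val_zero, Matrix.cons_val_one,
        Matrix.cons_val', Matrix.cons_val_fin_one] at hxA hxB
      grind
    | refine range_powerSumMap_eq_rowSubspace hk₁ hk₂ hA hB _ ?_ ?_ <;>
      · intro i hi j
        fin_cases i <;> fin_cases j <;> first | rfl | exact absurd rfl hi

end Table

/-! ### The surjectivity criterion -/

section Criterion

variable {K : Type*} [Field K]

theorem NoCommonZeroRow.of_surjective {k₁ k₂ : ℕ} {A B : Matrix (Fin 2) (Fin 2) K}
    (h : Function.Surjective (powerSumMap A B k₁ k₂)) : NoCommonZeroRow A B := by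
  rintro i ⟨hA, hB⟩
  obtain ⟨⟨X, Y⟩, hXY⟩ := h 1
  have h1 := congrFun (congrFun hXY i) i
  simp [powerSumMap, Matrix.mul_apply, hA, hB] at h1

theorem IsRepresentative.surjective_iff [IsAlgClosed K] {k₁ k₂ : ℕ} (hk₁ : 0 < k₁)
    (hk₂ : 0 < k₂) {A B : Matrix (Fin 2) (Fin 2) K} (hA : A ≠ 0) (hB : B ≠ 0)
    (h : IsRepresentative A B) :
    Function.Surjective (powerSumMap A B k₁ k₂) ↔ NoCommonZeroRow A B := by
  refine ⟨NoCommonZeroRow.of_surjective, fun hrow => ?_⟩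
  obtain ⟨W, hW⟩ := h.exists_imageTable
  have hrange := hW.range_powerSumMap hk₁ hk₂ hA hB
  obtain rfl | ⟨i, rfl⟩ := hW.eq_top_or_eq_rowSubspace
  · exact Set.range_eq_univ.mp hrange
  · have hmemA : A ∈ rowSubspace K i := by
      rw [← SetLike.mem_coe, ← hrange]
      exact ⟨(1, 0), by simp [powerSumMap, hk₂.ne']⟩
    have hmemB : B ∈ rowSubspace K i := by
      rw [← SetLike.mem_coe, ← hrange]
      exact ⟨(0, 1), by simp [powerSumMap, hk₁.ne']⟩
    obtain ⟨i', hi'⟩ := exists_ne i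
    exact (hrow i' ⟨hmemA i' hi', hmemB i' hi'⟩).elim

end Criterion

theorem theoremA {K : Type*} [Field K] [IsAlgClosed K] (k₁ k₂ : ℕ) (hk₁ : 0 < k₁) (hk₂ : 0 < k₂)
    (A B : Matrix (Fin 2) (Fin 2) K) (hA : A ≠ 0) (hB : B ≠ 0) :
    -- the pair is simultaneously conjugate to a representative
    (∃ P : GL (Fin 2) K, IsRepresentative (conjBy P A) (conjBy P B)) ∧
    -- surjectivity criterion on representatives
    (Function.Surjective (powerSumMap A B k₁ k₂) ↔
      ∃ P : GL (Fin 2) K, IsRepresentative (conjBy P A) (conjBy P B) ∧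
        NoCommonZeroRow (conjBy P A) (conjBy P B)) ∧
    -- surjectivity criterion on all simultaneous conjugates
    (Function.Surjective (powerSumMap A B k₁ k₂) ↔
      ∀ P : GL (Fin 2) K, NoCommonZeroRow (conjBy P A) (conjBy P B)) ∧
    -- every representative occurs in the table
    (IsRepresentative A B → ∃ W, ImageTable A B W) ∧
    -- the table gives the image
    (∀ W, ImageTable A B W → Set.range (powerSumMap A B k₁ k₂) = W) ∧
    -- the image of a representative is everything or one row
    (IsRepresentative A B →
      Set.range (powerSumMap A B k₁ k₂) = Set.univ ∨
        ∃ i, Set.range (powerSumMap A B k₁ k₂) = rowSubspace K i) ∧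
    -- the image is always a vector subspace
    (∃ W : Submodule K (Matrix (Fin 2) (Fin 2) K),
      Set.range (powerSumMap A B k₁ k₂) = W) := by 
  obtain ⟨P, hP⟩ := exists_conjBy_isRepresentative hA hB
  have hPsurj := hP.surjective_iff hk₁ hk₂ (conjBy_ne_zero P hA) (conjBy_ne_zero P hB)
  rw [surjective_powerSumMap_conjBy_iff] at hPsurj
  refine ⟨⟨P, hP⟩, ⟨fun h => ⟨P, hP, hPsurj.mp h⟩, ?_⟩, ⟨fun h Q => ?_, fun h => hPsurj.mpr (h P)⟩,
    IsRepresentative.exists_imageTable, fun W hW => hW.range_powerSumMap hk₁ hk₂ hA hB,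
    fun h => ?_, ⟨columnSpan A B, range_powerSumMap hk₁ hk₂ hA hB⟩⟩
  · rintro ⟨Q, hQ, hrow⟩
    rw [← surjective_powerSumMap_conjBy_iff Q]
    exact (hQ.surjective_iff hk₁ hk₂ (conjBy_ne_zero Q hA) (conjBy_ne_zero Q hB)).mpr hrow
  · rw [← surjective_powerSumMap_conjBy_iff Q] at h
    exact NoCommonZeroRow.of_surjective h
  · obtain ⟨W, hW⟩ := h.exists_imageTable
    have hrange := hW.range_powerSumMap hk₁ hk₂ hA hB
    obtain rfl | ⟨i, rfl⟩ := hW.eq_top_or_eq_rowSubspace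
    · exact Or.inl hrange
    · exact Or.inr ⟨i, hrange⟩
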